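/- A Latin square is called bachelor if it has no orthogonal mate. In dimension $n$, a set of mutually unbiased bases (MUBs) of $\mathbb{C}^n$ is called complete if it has $n+1$ members, and unextendible if no orthonormal basis of $\mathbb{C}^n$ is unbiased to all of its members. A basis is represented by the unitary matrix whose rows are its vectors. Let $d > 3$ and let $H$ be a real Hadamard matrix of order $d$ (entries $\pm 1$, $HH^T = d\,I$). Then bachelor Latin squares of order $d$ exist. Let $L$ be any of them. Index the coordinates of $\mathbb{C}^{d^2}$ by the cells $(r,c)$, $1\le r,c\le d$, and let $B_1,B_2,B_3$ be the real $d^2\times d^2$ matrices whose rows are indexed by pairs $(s,l)$, $1\le s,l\le d$, with entries $$ (B_1)_{(s,l),(r,c)} = \tfrac{1}{\sqrt d}\,\delta_{r,s}\,H_{c,l},\qquad (B_2)_{(s,l),(r,c)} = \tfrac{1}{\sqrt d}\,\delta_{c,s}\,H_{r,l},\qquad (B_3)_{(s,l),(r,c)} = \tfrac{1}{\sqrt d}\,\delta_{L(r,c),s}\,H_{r,l}. $$ Then: 1. $\{B_1,B_2,B_3\}$ is a set of three real MUBs in dimension $d^2$. 2. The standard form $\{B_1B_1^T,\ B_2B_1^T,\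 B_3B_1^T\}$ is again a set of three MUBs, $B_1B_1^T = I$, and $d\,B_2B_1^T$ and $d\,B_3B_1^T$ are real Hadamard matrices of order $d^2$. 3. Neither $\{B_1,B_2,B_3\}$ nor its standard form is contained in a complete set of $d^2+1$ MUBs of $\mathbb{C}^{d^2}$. 4. $\{B_1,B_2,B_3\}$ is contained in an unextendible set of $m$ MUBs of $\mathbb{C}^{d^2}$ with $3\le m\le d^2$. Consequently, there are infinitely many dimensions $n$, each of the form $n=d^2$ with $d>3$ the order of a real Hadamard matrix, in which there is an unextendible set of $m$ MUBs with $3\le m\le n$. -/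

import Mathlib

/-- `L` is a Latin square of order `d` (symbols, rows and columns indexed by `Fin d`):
every row and every column contains each symbol exactly once. -/
def IsLatinSquare {d : ℕ} (L : Fin d → Fin d → Fin d) : Prop :=
  (∀ r, Function.Bijective fun c => L r c) ∧ (∀ c, Function.Bijective fun r => L r c)

/-- Two squares are orthogonal if superimposing them yields every ordered pair of symbols
exactly once. -/
def AreOrthogonal {d : ℕ} (L M : Fin d → Fin d → Fin d) : Prop :=
  Function.Bijective fun x : Fin d × Fin d => (L x.1 x.2, M x.1 x.2)

/-- A bachelor Latin square: a Latin square without an orthogonal mate. -/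
def IsBachelor {d : ℕ} (L : Fin d → Fin d → Fin d) : Prop :=
  IsLatinSquare L ∧ ¬ ∃ M : Fin d → Fin d → Fin d, IsLatinSquare M ∧ AreOrthogonal L M

/-- Two bases, given by square matrices whose rows are the basis vectors, are unbiased:
`|⟨u, v⟩|² = 1 / n` for every `u` in the first and `v` in the second, `n` being the dimension. -/
def AreUnbiased {N : Type*} [Fintype N] (A B : Matrix N N ℂ) : Prop :=
  ∀ k l : N, ‖star (A k) ⬝ᵥ B l‖ ^ 2 = 1 / (Fintype.card N : ℝ)

/-- A family of mutually unbiased bases of `ℂ^N`. The rows of `B j` are the vectors of the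
`j`-th basis, so `B j` is unitary exactly when they form an orthonormal basis. -/
def IsMUB {N κ : Type*} [Fintype N] [DecidableEq N] (B : κ → Matrix N N ℂ) : Prop :=
  (∀ j, B j ∈ Matrix.unitaryGroup N ℂ) ∧ ∀ i j, i ≠ j → AreUnbiased (B i) (B j)

/-- The bases `B j` all belong to some complete set of MUBs, i.e. to a family of
`n + 1` mutually unbiased bases, `n` being the dimension. -/
def ExtendsToComplete {N κ : Type*} [Fintype N] [DecidableEq N] (B : κ → Matrix N N ℂ) : Prop :=
  ∃ C : Fin (Fintype.card N + 1) → Matrix N N ℂ, IsMUB C ∧ Set.range B ⊆ Set.range C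

/-- A family of MUBs to which no further basis, unbiased to all its members, can be added. -/
def IsUnextendible {N κ : Type*} [Fintype N] [DecidableEq N] (B : κ → Matrix N N ℂ) : Prop :=
  IsMUB B ∧ ¬ ∃ U ∈ Matrix.unitaryGroup N ℂ, ∀ j, AreUnbiased (B j) U

/-- A real matrix regarded as a complex one. -/
def complexify {N : Type*} (A : Matrix N N ℝ) : Matrix N N ℂ := A.map Complex.ofReal

/-- The basis of dimension `d ^ 2` obtained from a partition of the `d ^ 2` cells of a square into
`d` classes of `d` cells and a Hadamard matrix `H`. The cell `x` lies in the class `cls x`, as the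
cell number `pos x` of that class. The vector (row) with index `(s, l)` is supported on the class
`s`, and the entry at its `k`-th cell is the `k`-th entry of column `l` of `H`, divided by `√d`. -/
noncomputable def classBasis {d : ℕ} (cls pos : Fin d × Fin d → Fin d)
    (H : Matrix (Fin d) (Fin d) ℝ) : Matrix (Fin d × Fin d) (Fin d × Fin d) ℝ :=
  Matrix.of fun v x => if cls x = v.1 then H (pos x) v.2 / Real.sqrt d else 0

/-- The three bases obtained from a Latin square `L` and a Hadamard matrix `H`. The cells are
`(row, column)`; the three partitions of the cells are by row, by column, and by symbol, and the
cells of each class are numbered in the row-by-row (lexicographic) order, so by column number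
within a row, and by row number within a column or within a symbol class. -/
noncomputable def latinSquareBases {d : ℕ} (L : Fin d → Fin d → Fin d)
    (H : Matrix (Fin d) (Fin d) ℝ) : Fin 3 → Matrix (Fin d × Fin d) (Fin d × Fin d) ℝ :=
  ![classBasis Prod.fst Prod.snd H,
    classBasis Prod.snd Prod.fst H,
    classBasis (fun x => L x.1 x.2) Prod.fst H]

/-- The standard form of a triple of real bases: all of them are multiplied by the
transpose of the first, which turns the first into the identity. -/
def standardForm {N : Type*} [Fintype N] (B : Fin 3 → Matrix N N ℝ) : Fin 3 → Matrix N N ℝ :=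
  fun j => B j * (B 0).transpose

open scoped Matrix ComplexOrder Kronecker

/-! The obstruction to completeness is the 2-design property. For `κ` MUBs in dimension `n`, let `W`
have the tensor squares of all their vectors as columns, and let `F` be twice the symmetric
projection. The squared Hilbert–Schmidt norm of `W * Wᴴ - F` is `(κ - n - 1) * (κ - 2 * n)`. It
vanishes at `κ = n + 1`, so a complete set satisfies `W * Wᴴ = F`; it is negative at `κ = n + 2`
when `n > 2`, so `n + 2` MUBs cannot exist. Contracting `W * Wᴴ = F` with `∑ i, e i ⊗ e i` on both
sides gives `∑ |v ⬝ v|² = 2 * n`, the product being bilinear (`sum_norm_dotProduct_self_sq`). A real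
basis contributes `n`, so three of them are too many (`not_extendsToComplete_of_real`). A largest
family of MUBs containing the triple is then unextendible with at most `n` members. The triple
consists of MUBs because rows, columns and symbol classes of a Latin square cross pairwise in single
cells. Bachelor squares come from cyclic groups of even order. -/

/-- The matrix whose columns are the tensor squares `v k ⊗ v k`. -/
def tensorSquares {N ι : Type*} (v : ι → N → ℂ) : Matrix (N × N) ι ℂ :=
  Matrix.of fun p k => v k p.1 * v k p.2

/-- Twice the orthogonal projection of `ℂ^N ⊗ ℂ^N` onto the symmetric tensors. -/
def twiceSymProj (N : Type*) [DecidableEq N] : Matrix (N × N) (N × N) ℂ :=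
  1 + (1 : Matrix (N × N) (N × N) ℂ).submatrix Prod.swap id

/-! ### Frame operators of tensor squares. -/

section Design

variable {N ι : Type*}

theorem conjTranspose_tensorSquares_mul_apply [Fintype N] (v : ι → N → ℂ) (k l : ι) :
    ((tensorSquares v)ᴴ * tensorSquares v) k l = (star (v k) ⬝ᵥ v l) ^ 2 := by
  simp only [Matrix.mul_apply, Matrix.conjTranspose_apply, tensorSquares, Matrix.of_apply,
    dotProduct, sq, Finset.sum_mul_sum, Fintype.sum_prod_type, Pi.star_apply, star_mul']
  refine Finset.sum_congr rfl fun i _ => Finset.sum_congr rfl fun j _ => by ring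

variable [DecidableEq N]

theorem conjTranspose_twiceSymProj : (twiceSymProj N)ᴴ = twiceSymProj N := by
  ext p q
  simp only [twiceSymProj, Matrix.conjTranspose_apply, Matrix.add_apply, Matrix.submatrix_apply,
    Matrix.one_apply, id, star_add, apply_ite (star : ℂ → ℂ), star_one, star_zero]
  congr 1
  · simp only [eq_comm]
  · have : q.swap = p ↔ p.swap = q := by
      rw [Prod.swap_eq_iff_eq_swap, eq_comm]
    simp only [this]

variable [Fintype N]

theorem twiceSymProj_mul {κ : Type*} (A : Matrix (N × N) κ ℂ) :
    twiceSymProj N * A = A + A.submatrix Prod.swap id := by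
  have h := Matrix.submatrix_mul (1 : Matrix (N × N) (N × N) ℂ) A Prod.swap id id
    Function.bijective_id
  rw [twiceSymProj, Matrix.add_mul, Matrix.one_mul]
  rw [Matrix.one_mul, Matrix.submatrix_id_id] at h
  rw [← h]

theorem twiceSymProj_mul_tensorSquares (v : ι → N → ℂ) :
    twiceSymProj N * tensorSquares v = (2 : ℂ) • tensorSquares v := by
  rw [twiceSymProj_mul]
  ext p k
  simp [tensorSquares]
  ring

theorem twiceSymProj_mul_self :
    twiceSymProj N * twiceSymProj N = (2 : ℂ) • twiceSymProj N := by
  rw [twiceSymProj_mul]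
  ext p q
  simp only [twiceSymProj, Matrix.add_apply, Matrix.submatrix_apply, Matrix.smul_apply,
    Matrix.one_apply, id_eq, Prod.swap_swap, smul_eq_mul]
  ring

theorem trace_twiceSymProj :
    (twiceSymProj N).trace = (Fintype.card N : ℂ) ^ 2 + Fintype.card N := by
  rw [twiceSymProj, Matrix.trace_add, Matrix.trace_one, Fintype.card_prod]
  congr 1
  · push_cast; ring
  · simp only [Matrix.trace, Matrix.diag, Matrix.submatrix_apply, id, Matrix.one_apply,
      Fintype.sum_prod_type, Prod.swap_prod_mk, Prod.mk.injEq]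
    have : ∀ x y : N, (y = x ∧ x = y) ↔ x = y := fun x y => ⟨fun h => h.2, fun h => ⟨h.symm, h⟩⟩
    simp [this]

variable [Fintype ι]

/-- The squared Hilbert–Schmidt distance of the frame operator of the tensor squares to
`twiceSymProj`. -/
theorem trace_frame_sub_twiceSymProj (v : ι → N → ℂ) :
    ((tensorSquares v * (tensorSquares v)ᴴ - twiceSymProj N)ᴴ *
        (tensorSquares v * (tensorSquares v)ᴴ - twiceSymProj N)).trace =
      ((∑ k, ∑ l, ‖star (v k) ⬝ᵥ v l‖ ^ 4 - 4 * ∑ k, ‖star (v k) ⬝ᵥ v k‖ ^ 2 +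
        2 * ((Fintype.card N : ℝ) ^ 2 + Fintype.card N) : ℝ) : ℂ) := by
  set W := tensorSquares v with hW
  set F := twiceSymProj N with hF
  have h1 : F * (W * Wᴴ) = (2 : ℂ) • (W * Wᴴ) := by
    rw [← Matrix.mul_assoc, twiceSymProj_mul_tensorSquares, Matrix.smul_mul]
  have h2 : (W * Wᴴ) * F = (2 : ℂ) • (W * Wᴴ) := by
    have := congrArg Matrix.conjTranspose h1
    simpa [Matrix.conjTranspose_mul, hF, conjTranspose_twiceSymProj] using this
  have hexp : (W * Wᴴ - F)ᴴ * (W * Wᴴ - F) =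
      W * Wᴴ * (W * Wᴴ) - (4 : ℂ) • (W * Wᴴ) + (2 : ℂ) • F := by
    rw [Matrix.conjTranspose_sub, Matrix.conjTranspose_mul, Matrix.conjTranspose_conjTranspose,
      hF, conjTranspose_twiceSymProj, ← hF, Matrix.sub_mul, Matrix.mul_sub, Matrix.mul_sub, h1, h2,
      hF, twiceSymProj_mul_self, ← hF]
    module
  have hconj : ∀ k l, (star (v l) ⬝ᵥ v k) = star (star (v k) ⬝ᵥ v l) := fun k l => by
    rw [Matrix.star_dotProduct]
  have h4 : (W * Wᴴ * (W * Wᴴ)).trace = ((∑ k, ∑ l, ‖star (v k) ⬝ᵥ v l‖ ^ 4 : ℝ) : ℂ) := by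
    have htr : ∀ G : Matrix ι ι ℂ, (G * G).trace = ∑ k, ∑ l, G k l * G l k := fun G => by
      simp only [Matrix.trace, Matrix.diag, Matrix.mul_apply]
    -- Cyclicity of the trace replaces `W * Wᴴ` by the Gram matrix `Wᴴ * W`, whose entries are
    -- squared inner products.
    rw [Matrix.mul_assoc, Matrix.trace_mul_comm, ← Matrix.mul_assoc Wᴴ, Matrix.mul_assoc, htr]
    simp only [hW, conjTranspose_tensorSquares_mul_apply]
    push_cast
    refine Finset.sum_congr rfl fun k _ => Finset.sum_congr rfl fun l _ => ?_
    rw [hconj k l, ← mul_pow, Complex.star_def, Complex.mul_conj']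
    ring
  have h2' : (W * Wᴴ).trace = ((∑ k, ‖star (v k) ⬝ᵥ v k‖ ^ 2 : ℝ) : ℂ) := by
    rw [Matrix.trace_mul_comm]
    simp only [Matrix.trace, Matrix.diag, hW, conjTranspose_tensorSquares_mul_apply]
    push_cast
    refine Finset.sum_congr rfl fun k _ => ?_
    rw [← Complex.mul_conj', ← Complex.star_def, ← hconj, sq]
  rw [hexp, Matrix.trace_add, Matrix.trace_sub, Matrix.trace_smul, Matrix.trace_smul, h4, h2', hF,
    trace_twiceSymProj]
  push_cast
  simp only [smul_eq_mul]

/-- Both sides of `h` are contracted with `∑ i, e i ⊗ e i`, a symmetric tensor of squared norm `n`,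
on which `twiceSymProj` acts as multiplication by 2. -/
theorem sum_norm_dotProduct_self_sq {v : ι → N → ℂ}
    (h : tensorSquares v * (tensorSquares v)ᴴ = twiceSymProj N) :
    ∑ k, ‖v k ⬝ᵥ v k‖ ^ 2 = 2 * (Fintype.card N : ℝ) := by
  have h1 : ∑ i, ∑ j, (tensorSquares v * (tensorSquares v)ᴴ) (i, i) (j, j) =
      ((∑ k, ‖v k ⬝ᵥ v k‖ ^ 2 : ℝ) : ℂ) := by
    simp only [Matrix.mul_apply, Matrix.conjTranspose_apply, tensorSquares, Matrix.of_apply]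
    rw [Finset.sum_congr rfl fun i _ => Finset.sum_comm, Finset.sum_comm]
    push_cast
    refine Finset.sum_congr rfl fun k _ => ?_
    rw [← Complex.mul_conj', ← Complex.star_def]
    simp only [dotProduct, star_sum, Finset.sum_mul_sum]
  have h2 : ∑ i, ∑ j, twiceSymProj N (i, i) (j, j) = 2 * (Fintype.card N : ℂ) := by
    simp [twiceSymProj, Matrix.one_apply, Finset.sum_add_distrib]
    ring
  rw [h, h2] at h1
  exact_mod_cast h1.symm

end Design

/-! ### Size and extendibility of families of MUBs. -/

section MUB

variable {N κ : Type*} [Fintype N]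

theorem star_dotProduct_eq_mul_conjTranspose (A B : Matrix N N ℂ) (k l : N) :
    star (A k) ⬝ᵥ B l = (B * Aᴴ) l k := by
  simp [Matrix.mul_apply, dotProduct, mul_comm]

theorem areUnbiased_iff {A B : Matrix N N ℂ} :
    AreUnbiased A B ↔ ∀ k l, ‖(B * Aᴴ) l k‖ ^ 2 = 1 / (Fintype.card N : ℝ) := by
  simp only [AreUnbiased, star_dotProduct_eq_mul_conjTranspose]

theorem AreUnbiased.symm {A B : Matrix N N ℂ} (h : AreUnbiased A B) : AreUnbiased B A := by
  intro k l
  rw [← h l k, Matrix.star_dotProduct, norm_star]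

theorem areUnbiased_reindex_iff {M : Type*} [Fintype M] (e : N ≃ M) {A B : Matrix N N ℂ} :
    AreUnbiased (Matrix.reindex e e A) (Matrix.reindex e e B) ↔ AreUnbiased A B := by
  have key : ∀ k l, ‖(Matrix.reindex e e B * (Matrix.reindex e e A)ᴴ) l k‖ ^ 2 =
      ‖(B * Aᴴ) (e.symm l) (e.symm k)‖ ^ 2 := fun k l => by
    rw [Matrix.conjTranspose_reindex, Matrix.reindex_apply, Matrix.reindex_apply,
      Matrix.submatrix_mul_equiv, Matrix.submatrix_apply]
  simp only [areUnbiased_iff, key, ← Fintype.card_congr e]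
  exact ⟨fun h k l => by simpa using h (e k) (e l), fun h k l => h _ _⟩
variable [DecidableEq N]

theorem star_dotProduct_of_mem_unitaryGroup {A : Matrix N N ℂ}
    (h : A ∈ Matrix.unitaryGroup N ℂ) (k l : N) :
    star (A k) ⬝ᵥ A l = if l = k then 1 else 0 := by
  rw [star_dotProduct_eq_mul_conjTranspose, ← Matrix.star_eq_conjTranspose,
    Matrix.mem_unitaryGroup_iff.1 h, Matrix.one_apply]

/-- This makes members of a family of MUBs distinct, so that three bases occupy three different
places in a larger family. In dimension 1 a basis is unbiased to itself. -/
theorem AreUnbiased.ne {A B : Matrix N N ℂ} (hN : 1 < Fintype.card N)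
    (hA : A ∈ Matrix.unitaryGroup N ℂ) (h : AreUnbiased A B) : A ≠ B := by
  rintro rfl
  obtain ⟨k⟩ : Nonempty N := Fintype.card_pos_iff.1 (by omega)
  have := h k k
  rw [star_dotProduct_of_mem_unitaryGroup hA, if_pos rfl, norm_one, one_pow,
    eq_div_iff (by positivity)] at this
  have : Fintype.card N = 1 := by exact_mod_cast (one_mul (Fintype.card N : ℝ)).symm.trans this
  omega

theorem IsMUB.comp {κ' : Type*} {B : κ → Matrix N N ℂ} (h : IsMUB B) {f : κ' → κ}
    (hf : Function.Injective f) : IsMUB (B ∘ f) :=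
  ⟨fun _ => h.1 _, fun _ _ hij => h.2 _ _ (hf.ne hij)⟩

theorem reindex_mem_unitaryGroup {M : Type*} [Fintype M] [DecidableEq M] (e : N ≃ M)
    {A : Matrix N N ℂ} (h : A ∈ Matrix.unitaryGroup N ℂ) :
    Matrix.reindex e e A ∈ Matrix.unitaryGroup M ℂ := by
  rw [Matrix.mem_unitaryGroup_iff, Matrix.star_eq_conjTranspose] at h ⊢
  rw [Matrix.conjTranspose_reindex, Matrix.reindex_apply, Matrix.reindex_apply,
    Matrix.submatrix_mul_equiv, h, Matrix.submatrix_one_equiv]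

theorem IsUnextendible.reindex {M : Type*} [Fintype M] [DecidableEq M] (e : N ≃ M)
    {B : κ → Matrix N N ℂ} (h : IsUnextendible B) :
    IsUnextendible fun j => Matrix.reindex e e (B j) := by
  refine ⟨⟨fun j => reindex_mem_unitaryGroup e (h.1.1 j), fun i j hij =>
    (areUnbiased_reindex_iff e).2 (h.1.2 i j hij)⟩, ?_⟩
  rintro ⟨U, hU, hBU⟩
  refine h.2 ⟨Matrix.reindex e.symm e.symm U, reindex_mem_unitaryGroup e.symm hU, fun j => ?_⟩
  rw [← areUnbiased_reindex_iff e]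
  simpa using hBU j

variable [Fintype κ]

/-- A basis paired with itself contributes `n`; two different bases contribute `n ^ 2 * (1 / n) ^ 2
= 1`. -/
theorem IsMUB.sum_norm_pow_four [DecidableEq κ] {B : κ → Matrix N N ℂ} (h : IsMUB B)
    (hN : 0 < Fintype.card N) :
    ∑ x : κ × N, ∑ y : κ × N, ‖star (B x.1 x.2) ⬝ᵥ B y.1 y.2‖ ^ 4 =
      (Fintype.card κ : ℝ) * (Fintype.card N + Fintype.card κ - 1) := by
  have hn : (Fintype.card N : ℝ) ≠ 0 := by positivity
  have key : ∀ i j, ∑ k, ∑ l, ‖star (B i k) ⬝ᵥ B j l‖ ^ 4 =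
      (if i = j then (Fintype.card N : ℝ) - 1 else 0) + 1 := by
    intro i j
    split_ifs with hij
    · subst hij
      simp only [star_dotProduct_of_mem_unitaryGroup (h.1 i)]
      simp [apply_ite (fun z : ℂ => ‖z‖ ^ 4)]
    · have : ∀ k l, ‖star (B i k) ⬝ᵥ B j l‖ ^ 4 = (1 / (Fintype.card N : ℝ)) ^ 2 := fun k l => by
        rw [← h.2 i j hij k l]; ring
      simp only [this, Finset.sum_const, Finset.card_univ, nsmul_eq_mul]
      field_simp
      ring
  simp only [Fintype.sum_prod_type]
  rw [Finset.sum_congr rfl fun i _ => Finset.sum_comm]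
  simp only [key, Finset.sum_add_distrib, Finset.sum_ite_eq, Finset.mem_univ, if_true,
    Finset.sum_const, Finset.card_univ, nsmul_eq_mul]
  ring

theorem IsMUB.trace_frame_sub_twiceSymProj [DecidableEq κ] {B : κ → Matrix N N ℂ} (h : IsMUB B)
    (hN : 0 < Fintype.card N) :
    ((tensorSquares (fun x : κ × N => B x.1 x.2) *
          (tensorSquares fun x : κ × N => B x.1 x.2)ᴴ - twiceSymProj N)ᴴ *
        (tensorSquares (fun x : κ × N => B x.1 x.2) *
          (tensorSquares fun x : κ × N => B x.1 x.2)ᴴ - twiceSymProj N)).trace =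
      ((((Fintype.card κ : ℝ) - Fintype.card N - 1) *
        (Fintype.card κ - 2 * Fintype.card N) : ℝ) : ℂ) := by
  rw [_root_.trace_frame_sub_twiceSymProj, h.sum_norm_pow_four hN]
  have : ∑ x : κ × N, ‖star (B x.1 x.2) ⬝ᵥ B x.1 x.2‖ ^ 2 =
      (Fintype.card κ : ℝ) * Fintype.card N := by
    simp [star_dotProduct_of_mem_unitaryGroup (h.1 _)]
  rw [this]
  congr 1
  ring

/-- There are at most `n + 1` mutually unbiased bases in dimension `n`. -/
theorem IsMUB.card_le {B : κ → Matrix N N ℂ} (h : IsMUB B) (hN : 2 < Fintype.card N) :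
    Fintype.card κ ≤ Fintype.card N + 1 := by
  by_contra! hlt
  -- The quadratic is negative only strictly between `n + 1` and `2 * n`, so a subfamily of exactly
  -- `n + 2` bases is used; its value there is `2 - n`.
  obtain ⟨f⟩ : Nonempty (Fin (Fintype.card N + 2) ↪ κ) :=
    Function.Embedding.nonempty_of_card_le (by rw [Fintype.card_fin]; omega)
  have hf := (h.comp f.injective).trace_frame_sub_twiceSymProj (by omega)
  have hpos := (Matrix.posSemidef_conjTranspose_mul_self
    (tensorSquares (fun x : Fin (Fintype.card N + 2) × N => (B ∘ f) x.1 x.2) *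
      (tensorSquares fun x : Fin (Fintype.card N + 2) × N => (B ∘ f) x.1 x.2)ᴴ -
        twiceSymProj N)).trace_nonneg
  rw [hf, Complex.zero_le_real, Fintype.card_fin] at hpos
  push_cast at hpos
  have : (2 : ℝ) < Fintype.card N := by exact_mod_cast hN
  linarith

/-- The vectors of a complete set of mutually unbiased bases form a projective 2-design. -/
theorem IsMUB.frame_eq_twiceSymProj [DecidableEq κ] {B : κ → Matrix N N ℂ} (h : IsMUB B)
    (hN : 0 < Fintype.card N) (hκ : Fintype.card κ = Fintype.card N + 1) :
    tensorSquares (fun x : κ × N => B x.1 x.2) * (tensorSquares fun x : κ × N => B x.1 x.2)ᴴ =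
      twiceSymProj N := by
  rw [← sub_eq_zero, ← Matrix.trace_conjTranspose_mul_self_eq_zero_iff,
    h.trace_frame_sub_twiceSymProj hN, hκ]
  simp

theorem dotProduct_self_complexify {A : Matrix N N ℝ}
    (h : complexify A ∈ Matrix.unitaryGroup N ℂ) (k : N) :
    complexify A k ⬝ᵥ complexify A k = 1 := by
  have h1 := star_dotProduct_of_mem_unitaryGroup h k k
  rw [if_pos rfl] at h1
  rw [← h1]
  congr 1
  ext i
  simp [complexify]

/-- No complete set of mutually unbiased bases contains three real ones. -/
theorem not_extendsToComplete_of_real {B : Fin 3 → Matrix N N ℝ} (hN : 1 < Fintype.card N)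
    (h : IsMUB fun j => complexify (B j)) : ¬ ExtendsToComplete fun j => complexify (B j) := by
  rintro ⟨C, hC, hsub⟩
  choose f hf using fun j => hsub ⟨j, rfl⟩
  have hf_inj : Function.Injective f := by
    intro i j hij
    by_contra hne
    exact (h.2 i j hne).ne hN (h.1 i) (by rw [← hf i, ← hf j, hij])
  have hsum := sum_norm_dotProduct_self_sq
    (hC.frame_eq_twiceSymProj (by omega) (Fintype.card_fin _))
  rw [Fintype.sum_prod_type] at hsum
  have hle : ∑ j, ∑ k, ‖C (f j) k ⬝ᵥ C (f j) k‖ ^ 2 ≤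
      ∑ i, ∑ k, ‖C i k ⬝ᵥ C i k‖ ^ 2 := by
    rw [← Finset.sum_image (f := fun i => ∑ k, ‖C i k ⬝ᵥ C i k‖ ^ 2) hf_inj.injOn]
    exact Finset.sum_le_sum_of_subset_of_nonneg (Finset.subset_univ _) fun i _ _ =>
      Finset.sum_nonneg fun k _ => by positivity
  have hthree : ∑ j, ∑ k, ‖C (f j) k ⬝ᵥ C (f j) k‖ ^ 2 = 3 * (Fintype.card N : ℝ) := by
    simp only [hf, dotProduct_self_complexify (h.1 _)]
    simp
  have : (1 : ℝ) < Fintype.card N := by exact_mod_cast hN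
  rw [hthree] at hle
  linarith

/-- A family of mutually unbiased bases that is not part of a complete one is part of an
unextendible one with at most `n` members. -/
theorem IsMUB.exists_isUnextendible {m₀ : ℕ} {B : Fin m₀ → Matrix N N ℂ} (h : IsMUB B)
    (hN : 2 < Fintype.card N) (hB : ¬ ExtendsToComplete B) :
    ∃ m, m₀ ≤ m ∧ m ≤ Fintype.card N ∧ ∃ C : Fin m → Matrix N N ℂ,
      IsUnextendible C ∧ Set.range B ⊆ Set.range C := by
  classical
  let P : ℕ → Prop := fun m => ∃ C : Fin m → Matrix N N ℂ, IsMUB C ∧ Set.range B ⊆ Set.range C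
  have hP : ∀ m, P m → m ≤ Fintype.card N + 1 := fun m ⟨C, hC, _⟩ => by
    simpa using hC.card_le hN
  have hP₀ : P m₀ := ⟨B, h, subset_rfl⟩
  -- The bound `n + 1` on all sizes makes this `m` the true maximum, so adjoining one more basis
  -- contradicts it.
  set m := Nat.findGreatest P (Fintype.card N + 1) with hm
  have hle : m₀ ≤ m := Nat.le_findGreatest (hP _ hP₀) hP₀
  obtain ⟨C, hC, hsub⟩ : P m := Nat.findGreatest_spec (hP _ hP₀) hP₀
  have hne : m ≠ Fintype.card N + 1 := by
    intro heq
    clear_value m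
    subst heq
    exact hB ⟨C, hC, hsub⟩
  refine ⟨m, hle, ?_, C, ⟨hC, ?_⟩, hsub⟩
  · have := hP m ⟨C, hC, hsub⟩
    omega
  · rintro ⟨U, hU, hCU⟩
    have hP' : P (m + 1) := by
      refine ⟨Fin.cons U C, ⟨Fin.cases hU hC.1, ?_⟩, ?_⟩
      · refine Fin.cases (Fin.cases (fun h => (h rfl).elim) fun j _ => ?_) fun i =>
          Fin.cases (fun _ => ?_) fun j hij => ?_
        · simpa using (hCU j).symm
        · simpa using hCU i
        · simpa using hC.2 i j fun h => hij (by rw [h])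
      · refine hsub.trans ?_
        rw [Fin.range_cons]
        exact Set.subset_insert _ _
    have := Nat.le_findGreatest (hP _ hP') hP'
    omega

end MUB

/-! ### Orders of real Hadamard matrices. -/

section HadamardOrders

theorem Matrix.IsHadamard.sq_apply {N : Type*} [Fintype N] [DecidableEq N] {H : Matrix N N ℝ}
    (hH : H.IsHadamard) (i j : N) : H i j ^ 2 = 1 := by
  simpa [sq] using (Unitary.mem_iff.1 (hH.apply_mem i j)).1

/-- The order of a real Hadamard matrix is even once it exceeds one. -/
theorem Matrix.IsHadamard.even {d : ℕ} {H : Matrix (Fin d) (Fin d) ℝ} (hH : H.IsHadamard)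
    (hd : 1 < d) : Even d := by
  have horth : ∑ k, H ⟨0, by omega⟩ k * H ⟨1, hd⟩ k = 0 := by
    have := congrFun (congrFun hH.mul_conjTranspose ⟨0, by omega⟩) ⟨1, hd⟩
    simpa [Matrix.mul_apply] using this
  -- Here `b` is 0 or 1 and marks the places where the two rows disagree; orthogonality forces `d =
  -- 2 * ∑ b`.
  have hsign : ∀ k, ∃ b : ℤ, H ⟨0, by omega⟩ k * H ⟨1, hd⟩ k = 1 - 2 * (b : ℝ) := fun k => by
    have : (H ⟨0, by omega⟩ k * H ⟨1, hd⟩ k) ^ 2 = 1 := by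
      rw [mul_pow, hH.sq_apply, hH.sq_apply, one_mul]
    rcases sq_eq_one_iff.1 this with h | h
    · exact ⟨0, by rw [h]; norm_num⟩
    · exact ⟨1, by rw [h]; norm_num⟩
  choose b hb using hsign
  simp only [hb, Finset.sum_sub_distrib, ← Finset.mul_sum, Finset.sum_const, Finset.card_univ,
    Fintype.card_fin, nsmul_eq_mul, mul_one] at horth
  have : (d : ℤ) = 2 * ∑ k, b k := by
    have : (d : ℝ) = 2 * ∑ k, (b k : ℝ) := by linarith
    exact_mod_cast this
  exact (Int.even_coe_nat d).1 ⟨_, this.trans (two_mul _)⟩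

theorem exists_isHadamard_two_pow (k : ℕ) :
    ∃ H : Matrix (Fin (2 ^ k)) (Fin (2 ^ k)) ℝ, H.IsHadamard := by
  have h2 : (!![1, 1; 1, -1] : Matrix (Fin 2) (Fin 2) ℝ).IsHadamard := by
    refine ⟨?_, ?_, ?_⟩
    · intro i j
      fin_cases i <;> fin_cases j <;> simp [Unitary.mem_iff]
    all_goals
      ext i j
      fin_cases i <;> fin_cases j <;> norm_num [Matrix.mul_apply, Fin.sum_univ_two]
  induction k with
  | zero =>
    refine ⟨1, fun i j => ?_, ?_, ?_⟩
    · rw [Subsingleton.elim (α := Fin 1) i j, Matrix.one_apply_eq]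
      exact one_mem _
    all_goals simp
  | succ k ih =>
    obtain ⟨H, hH⟩ := ih
    exact ⟨_, (hH.kronecker h2).reindex finProdFinEquiv finProdFinEquiv⟩

end HadamardOrders

/-! ### A bachelor Latin square of every even order. -/

section CyclicLatinSquare

open Fin.CommRing in
/-- The addition table of a cyclic group of even order is a bachelor Latin square. -/
theorem isBachelor_add {d : ℕ} [NeZero d] (hd : Even d) :
    IsBachelor fun r c : Fin d => r + c := by
  refine ⟨⟨fun r => (Equiv.addLeft r).bijective, fun c => (Equiv.addRight c).bijective⟩, ?_⟩
  rintro ⟨M, hM, hLM⟩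
  obtain ⟨m, hm⟩ := hd
  -- the cells with symbol `0` in `M` form a transversal
  choose col hcol using fun r => (hM.1 r).2 0
  have hcol_inj : Function.Injective col := fun r r' h =>
    by
    have h' : M r (col r) = M r' (col r) := (hcol r).trans (by rw [h]; exact (hcol r').symm)
    exact (hM.2 (col r)).1 h'
  have hadd_inj : Function.Injective fun r => r + col r := fun r r' h =>
    congrArg Prod.fst (hLM.1 (a₁ := (r, col r)) (a₂ := (r', col r'))
      (Prod.ext h ((hcol r).trans (hcol r').symm)))
  -- Rows, columns and symbols of the transversal each run through all of `Fin d`. Summing `r + col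
  -- r` gives `∑ r = 0`, that is `d ∣ d * (d - 1) / 2`, which is false for even `d`.
  have h1 : ∑ r, col r = ∑ r : Fin d, r :=
    (Equiv.ofBijective col (Finite.injective_iff_bijective.1 hcol_inj)).sum_comp id
  have h2 : ∑ r, (r + col r) = ∑ r : Fin d, r :=
    (Equiv.ofBijective _ (Finite.injective_iff_bijective.1 hadd_inj)).sum_comp id
  rw [Finset.sum_add_distrib, h1, add_eq_left] at h2
  have h3 : ((∑ i ∈ Finset.range d, i :) : Fin d) = 0 := by
    rw [← h2, Finset.sum_range, Nat.cast_sum]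
    exact Finset.sum_congr rfl fun i _ => Fin.cast_val_eq_self i
  rw [Fin.natCast_eq_zero] at h3
  have h4 := Finset.sum_range_id_mul_two d
  obtain ⟨q, hq⟩ := h3
  have hd0 : 0 < d := Nat.pos_of_ne_zero (NeZero.ne d)
  rw [hq, mul_assoc] at h4
  have := Nat.eq_of_mul_eq_mul_left hd0 h4
  omega

end CyclicLatinSquare

/-! ### Bases supported on partitions of the cells. -/

section ClassBasis

variable {d : ℕ} {H : Matrix (Fin d) (Fin d) ℝ}

theorem classBasis_mul_transpose_self {cls pos : Fin d × Fin d → Fin d} (hd : 0 < d)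
    (hH : H.IsHadamard) (hbij : Function.Bijective fun x => (cls x, pos x)) :
    classBasis cls pos H * (classBasis cls pos H)ᵀ = 1 := by
  have hd' : (0 : ℝ) < d := by exact_mod_cast hd
  ext ⟨s, l⟩ ⟨t, m⟩
  -- Reindexing cells by class and position reduces the inner product to one of two columns of `H`.
  have hsum := (Equiv.ofBijective _ hbij).sum_comp fun y : Fin d × Fin d =>
    (if y.1 = s then H y.2 l / Real.sqrt d else 0) *
      (if y.1 = t then H y.2 m / Real.sqrt d else 0)
  have horth : ∑ k, H k l * H k m = if l = m then (d : ℝ) else 0 := by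
    have := congrFun (congrFun hH.conjTranspose_mul l) m
    simpa [Matrix.mul_apply, Matrix.one_apply] using this
  simp only [Matrix.mul_apply, Matrix.transpose_apply, classBasis, Matrix.of_apply]
  refine hsum.trans ?_
  rw [Fintype.sum_prod_type]
  have hterm : ∀ i k, (if i = s then H k l / Real.sqrt d else 0) *
      (if i = t then H k m / Real.sqrt d else 0) =
      if i = s then if s = t then H k l * H k m / d else 0 else 0 := by
    intro i k
    by_cases h1 : i = s
    · subst h1
      by_cases h2 : i = t
      · simp only [h2, if_true]
        rw [div_mul_div_comm, Real.mul_self_sqrt hd'.le]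
      · simp [h2]
    · simp [h1]
  simp only [hterm]
  rw [Finset.sum_comm]
  simp only [Finset.sum_ite_eq', Finset.mem_univ, if_true]
  by_cases hst : s = t
  · simp only [hst, if_true, ← Finset.sum_div, horth, Matrix.one_apply, Prod.mk.injEq, true_and]
    split_ifs
    · exact div_self hd'.ne'
    · exact zero_div _
  · simp [hst]

/-- If each class of one partition meets each class of the other in exactly one cell, then the
inner products of the vectors of the two bases are `±1 / d`. -/
theorem sq_classBasis_mul_transpose_apply {cls pos cls' pos' : Fin d × Fin d → Fin d}
    (hH : H.IsHadamard) (hbij : Function.Bijective fun x => (cls x, cls' x))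
    (v w : Fin d × Fin d) :
    (classBasis cls pos H * (classBasis cls' pos' H)ᵀ) v w ^ 2 = 1 / (d : ℝ) ^ 2 := by
  obtain ⟨x, hx⟩ := hbij.2 (v.1, w.1)
  rw [Matrix.mul_apply, Finset.sum_eq_single x]
  · simp only [Prod.mk.injEq] at hx
    simp only [Matrix.transpose_apply, classBasis, Matrix.of_apply, hx.1, hx.2, if_true]
    rw [mul_pow, div_pow, div_pow, hH.sq_apply, hH.sq_apply, Real.sq_sqrt (by positivity)]
    ring
  · intro y _ hy
    simp only [Matrix.transpose_apply, classBasis, Matrix.of_apply]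
    by_cases h1 : cls y = v.1
    · have h2 : cls' y ≠ w.1 := fun h2 => hy (hbij.1 ((Prod.ext h1 h2).trans hx.symm))
      simp [h2]
    · simp [h1]
  · simp

end ClassBasis

section RealMUB

variable {N : Type*} [Fintype N]

theorem complexify_mul_conjTranspose (A B : Matrix N N ℝ) :
    complexify A * (complexify B)ᴴ = complexify (A * Bᵀ) := by
  ext i j
  simp [complexify, Matrix.mul_apply]

variable [DecidableEq N]

/-- A criterion for real matrices to form a family of mutually unbiased bases. -/
theorem isMUB_complexify {κ : Type*} {B : κ → Matrix N N ℝ} (h1 : ∀ j, B j * (B j)ᵀ = 1)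
    (h2 : ∀ i j, i ≠ j → ∀ v w, (B i * (B j)ᵀ) v w ^ 2 = 1 / (Fintype.card N : ℝ)) :
    IsMUB fun j => complexify (B j) := by
  refine ⟨fun j => ?_, fun i j hij => areUnbiased_iff.2 fun k l => ?_⟩
  · rw [Matrix.mem_unitaryGroup_iff, Matrix.star_eq_conjTranspose, complexify_mul_conjTranspose,
      h1]
    simp [complexify]
  · rw [complexify_mul_conjTranspose, ← h2 j i hij.symm l k]
    simp [complexify]

end RealMUB

/-! ### The three bases of a Latin square. -/

section LatinSquareBases

variable {d : ℕ} {H : Matrix (Fin d) (Fin d) ℝ} {L : Fin d → Fin d → Fin d}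

theorem bijective_prodMk_fst {A B C : Type*} [Finite A] [Finite B] {f : A → B → C}
    {g : A × B → A × C} (hg : ∀ x, g x = (x.1, f x.1 x.2))
    (hf : ∀ r, Function.Bijective (f r)) : Function.Bijective g := by
  refine ⟨fun x y h => ?_, fun z => ?_⟩
  · rw [hg, hg, Prod.mk.injEq] at h
    refine Prod.ext h.1 ((hf x.1).1 (h.2.trans ?_))
    rw [h.1]
  · obtain ⟨c, hc⟩ := (hf z.1).2 z.2
    exact ⟨(z.1, c), by rw [hg]; exact Prod.ext rfl hc⟩

theorem IsLatinSquare.bijective_fst (hL : IsLatinSquare L) :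
    Function.Bijective fun x : Fin d × Fin d => (x.1, L x.1 x.2) :=
  bijective_prodMk_fst (fun _ => rfl) hL.1

theorem IsLatinSquare.bijective_snd (hL : IsLatinSquare L) :
    Function.Bijective fun x : Fin d × Fin d => (x.2, L x.1 x.2) :=
  (bijective_prodMk_fst (f := fun c r => L r c) (fun _ => rfl) hL.2).comp
    (Equiv.prodComm _ _).bijective

theorem latinSquareBases_mul_transpose_self (hd : 0 < d) (hH : H.IsHadamard)
    (hL : IsLatinSquare L) (j : Fin 3) :
    latinSquareBases L H j * (latinSquareBases L H j)ᵀ = 1 := by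
  have hswap := (Equiv.prodComm (Fin d) (Fin d)).bijective
  fin_cases j
  · exact classBasis_mul_transpose_self hd hH Function.bijective_id
  · exact classBasis_mul_transpose_self hd hH hswap
  · exact classBasis_mul_transpose_self hd hH (hswap.comp hL.bijective_fst)

theorem sq_latinSquareBases_mul_transpose_apply (hH : H.IsHadamard) (hL : IsLatinSquare L)
    (i j : Fin 3) (hij : i ≠ j) (v w : Fin d × Fin d) :
    (latinSquareBases L H i * (latinSquareBases L H j)ᵀ) v w ^ 2 = 1 / (d : ℝ) ^ 2 := by
  have hswap := (Equiv.prodComm (Fin d) (Fin d)).bijective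
  fin_cases i <;> fin_cases j
  · exact (hij rfl).elim
  · exact sq_classBasis_mul_transpose_apply hH Function.bijective_id v w
  · exact sq_classBasis_mul_transpose_apply hH hL.bijective_fst v w
  · exact sq_classBasis_mul_transpose_apply hH hswap v w
  · exact (hij rfl).elim
  · exact sq_classBasis_mul_transpose_apply hH hL.bijective_snd v w
  · exact sq_classBasis_mul_transpose_apply hH (hswap.comp hL.bijective_fst) v w
  · exact sq_classBasis_mul_transpose_apply hH (hswap.comp hL.bijective_snd) v w
  · exact (hij rfl).elim

theorem isMUB_latinSquareBases (hd : 0 < d) (hH : H.IsHadamard) (hL : IsLatinSquare L) :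
    IsMUB fun j => complexify (latinSquareBases L H j) :=
  isMUB_complexify (latinSquareBases_mul_transpose_self hd hH hL) fun i j hij v w => by
    rw [sq_latinSquareBases_mul_transpose_apply hH hL i j hij, Fintype.card_prod, Fintype.card_fin]
    push_cast
    ring

end LatinSquareBases

/-! ### Passage to standard form. -/

section StandardForm

variable {N : Type*} [Fintype N] [DecidableEq N] {B : Fin 3 → Matrix N N ℝ}

/-- Right multiplication by an orthogonal matrix preserves all inner products of rows, so
orthonormality and unbiasedness carry over. -/
theorem standardForm_mul_transpose (h : B 0 * (B 0)ᵀ = 1) (i j : Fin 3) :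
    standardForm B i * (standardForm B j)ᵀ = B i * (B j)ᵀ := by
  rw [standardForm, standardForm, Matrix.transpose_mul, Matrix.transpose_transpose,
    Matrix.mul_assoc, ← Matrix.mul_assoc (B 0)ᵀ, mul_eq_one_comm.1 h, Matrix.one_mul]

theorem isHadamard_smul {A : Matrix N N ℝ} {c : ℝ} (hc : c ^ 2 = Fintype.card N)
    (hA : A * Aᵀ = 1) (hentry : ∀ v w, A v w ^ 2 = 1 / c ^ 2) (hc0 : c ≠ 0) :
    (c • A).IsHadamard := by
  refine ⟨fun v w => ?_, ?_, ?_⟩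
  · have : (c * A v w) * (c * A v w) = 1 := by
      rw [← sq, mul_pow, hentry]
      field_simp
    simpa [Unitary.mem_iff] using this
  · rw [Matrix.conjTranspose_eq_transpose_of_trivial, Matrix.transpose_smul, Matrix.smul_mul,
      Matrix.mul_smul, hA, smul_smul, ← sq, hc]
  · rw [Matrix.conjTranspose_eq_transpose_of_trivial, Matrix.transpose_smul, Matrix.smul_mul,
      Matrix.mul_smul, mul_eq_one_comm.1 hA, smul_smul, ← sq, hc]

end StandardForm

/-! ### Assembly of the main theorem. -/

theorem latinSquareBases_properties {d : ℕ} {H : Matrix (Fin d) (Fin d) ℝ} (hd : 3 < d)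
    (hH : H.IsHadamard) {L : Fin d → Fin d → Fin d} (hL : IsLatinSquare L) :
    IsMUB (fun j => complexify (latinSquareBases L H j)) ∧
      IsMUB (fun j => complexify (standardForm (latinSquareBases L H) j)) ∧
      standardForm (latinSquareBases L H) 0 = 1 ∧
      ((d : ℝ) • standardForm (latinSquareBases L H) 1).IsHadamard ∧
      ((d : ℝ) • standardForm (latinSquareBases L H) 2).IsHadamard ∧
      ¬ ExtendsToComplete (fun j => complexify (latinSquareBases L H j)) ∧
      ¬ ExtendsToComplete (fun j => complexify (standardForm (latinSquareBases L H) j)) ∧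
      ∃ m : ℕ, 3 ≤ m ∧ m ≤ d ^ 2 ∧
        ∃ C : Fin m → Matrix (Fin d × Fin d) (Fin d × Fin d) ℂ, IsUnextendible C ∧
          Set.range (fun j => complexify (latinSquareBases L H j)) ⊆ Set.range C := by
  have hcard : Fintype.card (Fin d × Fin d) = d ^ 2 := by
    rw [Fintype.card_prod, Fintype.card_fin, sq]
  have hN : 2 < Fintype.card (Fin d × Fin d) := by rw [hcard]; nlinarith
  have horth := latinSquareBases_mul_transpose_self (by omega) hH hL
  have hunb := sq_latinSquareBases_mul_transpose_apply hH hL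
  have hstd := standardForm_mul_transpose (horth 0)
  have hmub := isMUB_latinSquareBases (by omega) hH hL
  have hmub' : IsMUB (fun j => complexify (standardForm (latinSquareBases L H) j)) :=
    isMUB_complexify (fun j => by rw [hstd, horth]) fun i j hij v w => by
      rw [hstd, hunb i j hij, hcard, Nat.cast_pow]
  have hhad : ∀ j, j ≠ 0 → ((d : ℝ) • standardForm (latinSquareBases L H) j).IsHadamard :=
    fun j hj => isHadamard_smul (by rw [hcard, Nat.cast_pow]) (by rw [hstd, horth])
      (hunb j 0 hj) (by positivity)
  have hno := not_extendsToComplete_of_real (by omega) hmub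
  refine ⟨hmub, hmub', horth 0, hhad 1 (by decide), hhad 2 (by decide), hno,
    not_extendsToComplete_of_real (by omega) hmub', ?_⟩
  rw [← hcard]
  exact hmub.exists_isUnextendible hN hno

theorem mainTheorem4 :
    -- every real Hadamard matrix of order `d > 3`, with every bachelor Latin square of order `d`
    (∀ (d : ℕ) (H : Matrix (Fin d) (Fin d) ℝ), 3 < d → H.IsHadamard →
      (∃ L : Fin d → Fin d → Fin d, IsBachelor L) ∧
      ∀ L : Fin d → Fin d → Fin d, IsBachelor L →
        -- three real MUBs in dimension `d ^ 2`
        IsMUB (fun j => complexify (latinSquareBases L H j)) ∧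
        -- their standard form: again MUBs, the identity and two real Hadamard matrices
        -- (`d` is the square root of the dimension)
        IsMUB (fun j => complexify (standardForm (latinSquareBases L H) j)) ∧
        standardForm (latinSquareBases L H) 0 = 1 ∧
        ((d : ℝ) • standardForm (latinSquareBases L H) 1).IsHadamard ∧
        ((d : ℝ) • standardForm (latinSquareBases L H) 2).IsHadamard ∧
        -- neither triple extends to a complete set of MUBs
        ¬ ExtendsToComplete (fun j => complexify (latinSquareBases L H j)) ∧
        ¬ ExtendsToComplete (fun j => complexify (standardForm (latinSquareBases L H) j)) ∧
        -- the triple is part of an unextendible set of at most `d ^ 2` MUBs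
        ∃ m : ℕ, 3 ≤ m ∧ m ≤ d ^ 2 ∧
          ∃ C : Fin m → Matrix (Fin d × Fin d) (Fin d × Fin d) ℂ, IsUnextendible C ∧
            Set.range (fun j => complexify (latinSquareBases L H j)) ⊆ Set.range C) ∧
    -- unextendible, incomplete sets of MUBs occur in infinitely many dimensions `n = d ^ 2`
    {n : ℕ | ∃ d : ℕ, 3 < d ∧ n = d ^ 2 ∧
      (∃ H : Matrix (Fin d) (Fin d) ℝ, H.IsHadamard) ∧
      ∃ m : ℕ, 3 ≤ m ∧ m ≤ n ∧
        ∃ C : Fin m → Matrix (Fin n) (Fin n) ℂ, IsUnextendible C}.Infinite := by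
  have hbach : ∀ (d : ℕ) (H : Matrix (Fin d) (Fin d) ℝ), 3 < d → H.IsHadamard →
      ∃ L : Fin d → Fin d → Fin d, IsBachelor L := fun d H hd hH => by
    have : NeZero d := ⟨by omega⟩
    exact ⟨_, isBachelor_add (hH.even (by omega))⟩
  refine ⟨fun d H hd hH => ⟨hbach d H hd hH, fun L hL =>
    latinSquareBases_properties hd hH hL.1⟩, ?_⟩
  -- Sylvester's Hadamard matrices have order `2 ^ k`; the shift by 2 ensures `d ≥ 4`.
  refine Set.infinite_of_injective_forall_mem (f := fun k : ℕ => (2 ^ (k + 2)) ^ 2) ?_ fun k => ?_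
  · intro a b hab
    have := Nat.pow_left_injective two_ne_zero hab
    have := Nat.pow_right_injective le_rfl this
    omega
  · have hd : 3 < 2 ^ (k + 2) := by
      have := Nat.one_le_two_pow (n := k)
      rw [pow_add]
      omega
    obtain ⟨H, hH⟩ := exists_isHadamard_two_pow (k + 2)
    obtain ⟨L, hL⟩ := hbach _ H hd hH
    obtain ⟨-, -, -, -, -, -, -, m, hm, hm', C, hC, -⟩ := latinSquareBases_properties hd hH hL.1
    exact ⟨2 ^ (k + 2), hd, rfl, ⟨H, hH⟩, m, hm, hm', _,
      hC.reindex (finProdFinEquiv.trans (finCongr (sq _).symm))⟩
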